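/- All groups are finite. For a group $G$ let $\pi(G)$ be the set of prime divisors of $|G|$ and $\Phi(G)$ the Frattini subgroup. A Schmidt group is a non-nilpotent group all of whose proper subgroups are nilpotent; a Schmidt $(p,q)$-group is a Schmidt group $H$ with $\pi(H)=\{p,q\}$ and normal Sylow $p$-subgroup. A (directed) graph is a pair of a vertex set and a set of ordered pairs of vertices; inclusion and union of graphs are taken for vertices and for edges. The Schmidt graph $\Gamma_{Sch}(G)$ has vertex set $\pi(G)$, and $(p,q)$ is an edge if and only if $G$ contains a Schmidt $(p,q)$-group as a subgroup. **Proposition.** The function $\Gamma=\Gamma_{Sch}$ is an arithmetic graph function (the vertices of $\Gamma(G)$ are divisors of $|G|$, and $\Gamma(1)=\emptyset$), and it is - $\mathbf{S}$-closed: $\Gamma(H)\subseteq\Gamma(G)$ for every group $G$ and every $H\le G$; - $\mathbf{Q}$-closed: $\Gamma(G/N)\subseteq\Gamma(G)$ for every group $G$ and every $N\trianglelefteq G$; - $\mathbf{D}_0$-closed: $\Gamma(G_1\times\dots\times G_n)=\Gamma(G_1)\cup\dots\cup\Gamma(G_n)$ for all groups $G_1,\dots,G_n$; - $\mathbf{R}_0$-closed: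 $\Gamma(G/N_1)\cup\dots\cup\Gamma(G/N_n)=\Gamma\bigl(G/\bigcap_{i=1}^n N_i\bigr)$ for every group $G$ and all normal subgroups $N_1,\dots,N_n$ of $G$. It is not $\mathbf{E}_\Phi$-closed: it is not true that $\Gamma(G/\Phi(G))=\Gamma(G)$ for every group $G$. More precisely, there are a faithful irreducible $\mathbb{F}_3A_5$-module $A$ and a finite group $R$ with an exact sequence $A\rightarrowtail R\twoheadrightarrow A_5$ that is a Frattini extension (conjugation in $R$ induces on $A$ the given action of $A_5$, and the image of $A$ is contained in $\Phi(R)$; so $A$ is a Frattini module), such that the image of $A$ equals $\Phi(R)$, $R/\Phi(R)\simeq A_5$, $R$ contains a Schmidt $(3,5)$-subgroup, $A_5$ contains no Schmidt $(3,5)$-subgroup, and hence $\Gamma(R/\Phi(R))\neq\Gamma(R)$. -/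

import Mathlib

universe u

/-- The set `π(G)` of prime divisors of the order of a finite group `G`. -/
def primeDivisors (G : Type*) [Group G] : Set ℕ :=
  {p | p.Prime ∧ p ∣ Nat.card G}

/-- A directed graph (loops allowed) whose vertices are natural numbers: a set of vertices and a
set of ordered pairs of vertices. -/
@[ext]
structure NatDigraph where
  verts : Set ℕ
  edges : Set (ℕ × ℕ)
  edges_subset : edges ⊆ verts ×ˢ verts

namespace NatDigraph

/-- `Γ₁ ≤ Γ₂` means that `Γ₁` is a subgraph of `Γ₂`. -/
instance : LE NatDigraph where
  le Γ₁ Γ₂ := Γ₁.verts ⊆ Γ₂.verts ∧ Γ₁.edges ⊆ Γ₂.edges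

/-- The graph with no vertices. -/
def empty : NatDigraph where
  verts := ∅
  edges := ∅
  edges_subset := Set.empty_subset _

/-- The union of a family of graphs. -/
def union {ι : Type*} (Γ : ι → NatDigraph) : NatDigraph where
  verts := ⋃ i, (Γ i).verts
  edges := ⋃ i, (Γ i).edges
  edges_subset := by
    intro e he
    obtain ⟨i, hi⟩ := Set.mem_iUnion.mp he
    have h := (Γ i).edges_subset hi
    exact ⟨Set.mem_iUnion.mpr ⟨i, h.1⟩, Set.mem_iUnion.mpr ⟨i, h.2⟩⟩

end NatDigraph

/-- A graph function assigns a graph to every finite group. -/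
abbrev GraphFunction : Type (u + 1) :=
  (G : Type u) → [Group G] → [Finite G] → NatDigraph

namespace GraphFunction

/-- The vertices of `Γ(G)` are divisors of `|G|`, and `Γ(1)` is the empty graph. -/
def IsArithmetic (Γ : GraphFunction.{u}) : Prop :=
  (∀ (G : Type u) [Group G] [Finite G], (Γ G).verts ⊆ {d | d ∣ Nat.card G}) ∧
  (∀ (G : Type u) [Group G] [Finite G], Subsingleton G → Γ G = NatDigraph.empty)

/-- `Γ(H) ⊆ Γ(G)` for all subgroups `H ≤ G`. -/
def SClosed (Γ : GraphFunction.{u}) : Prop :=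
  ∀ (G : Type u) [Group G] [Finite G] (H : Subgroup G), Γ H ≤ Γ G

/-- `Γ(G/N) ⊆ Γ(G)` for all normal subgroups `N` of `G`. -/
def QClosed (Γ : GraphFunction.{u}) : Prop :=
  ∀ (G : Type u) [Group G] [Finite G] (N : Subgroup G) [N.Normal], Γ (G ⧸ N) ≤ Γ G

/-- `Γ(G₁ × ⋯ × Gₙ) = Γ(G₁) ∪ ⋯ ∪ Γ(Gₙ)`. -/
def D0Closed (Γ : GraphFunction.{u}) : Prop :=
  ∀ (n : ℕ) (G : Fin n → Type u) [∀ i, Group (G i)] [∀ i, Finite (G i)],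
    Γ ((i : Fin n) → G i) = NatDigraph.union fun i => Γ (G i)

/-- `Γ(G/N₁) ∪ ⋯ ∪ Γ(G/Nₙ) = Γ(G/(N₁ ∩ ⋯ ∩ Nₙ))` for all normal subgroups `N₁, …, Nₙ` of `G`. -/
def R0Closed (Γ : GraphFunction.{u}) : Prop :=
  ∀ (G : Type u) [Group G] [Finite G] (n : ℕ) (N : Fin n → Subgroup G)
    (hN : ∀ i, (N i).Normal),
    haveI : (⨅ i, N i).Normal := Subgroup.normal_iInf_normal hN
    (NatDigraph.union fun i => Γ (G ⧸ N i)) = Γ (G ⧸ ⨅ i, N i)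

/-- `Γ(G/Φ(G)) = Γ(G)` for every group `G`. -/
def EPhiClosed (Γ : GraphFunction.{u}) : Prop :=
  ∀ (G : Type u) [Group G] [Finite G], Γ (G ⧸ frattini G) = Γ G

end GraphFunction

/-- A Schmidt group is a non-nilpotent group all of whose proper subgroups are nilpotent. -/
def IsSchmidt (G : Type*) [Group G] : Prop :=
  ¬ Group.IsNilpotent G ∧ ∀ H : Subgroup G, H ≠ ⊤ → Group.IsNilpotent H

/-- A Schmidt `(p, q)`-group is a Schmidt group `G` with `π(G) = {p, q}` and normal Sylow
`p`-subgroup. -/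
def IsSchmidtPQ (p q : ℕ) (G : Type*) [Group G] : Prop :=
  IsSchmidt G ∧ primeDivisors G = {p, q} ∧ ∃ P : Sylow p G, (P : Subgroup G).Normal

/-- `G` contains a Schmidt `(p, q)`-group as a subgroup. -/
def HasSchmidtSubgroup (p q : ℕ) (G : Type*) [Group G] : Prop :=
  ∃ H : Subgroup G, IsSchmidtPQ p q H

/-- The Schmidt graph function `Γ_Sch`. -/
def schmidtGraph : GraphFunction.{u} := fun G _ _ =>
  { verts := primeDivisors G
    edges := {e | HasSchmidtSubgroup e.1 e.2 G}
    edges_subset := by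
      rintro ⟨p, q⟩ ⟨H, -, hπ, -⟩
      have key : ∀ r ∈ primeDivisors H, r ∈ primeDivisors G := fun r hr =>
        ⟨hr.1, hr.2.trans (Subgroup.card_subgroup_dvd_card H)⟩
      exact ⟨key p (by rw [hπ]; exact Or.inl rfl), key q (by rw [hπ]; exact Or.inr rfl)⟩ }

/-- The exact sequence `A ↣ R ↠ G` is a Frattini extension of `G` by the `KG`-module `(A, ρ)`:
conjugation in `R` induces on `A` the given action of `G`, and the image of `A` lies in `Φ(R)`.
A finite module that occurs in such a sequence with `R` finite is called a Frattini `KG`-module. -/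
structure IsFrattiniExtension {K G A R : Type*} [Field K] [Group G] [AddCommGroup A] [Module K A]
    [Group R] (ρ : Representation K G A) (S : GroupExtension (Multiplicative A) R G) : Prop where
  conj_eq : ∀ (r : R) (a : A), r * S.inl (Multiplicative.ofAdd a) * r⁻¹ =
    S.inl (Multiplicative.ofAdd (ρ (S.rightHom r) a))
  range_le_frattini : S.inl.range ≤ frattini R

/-!
A group contains a Schmidt `(p, q)`-subgroup if and only if it has a non-nilpotent subgroup `H` with
a normal `p`-subgroup whose quotient is a `q`-group. If `H` is a subgroup of a quotient `G/N`, a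
subgroup of `G` minimal among those mapping onto `H` is a Frattini extension of `H`, hence again of
this kind. This gives closure under quotients. If all projections of a subgroup of a direct product
are nilpotent, so is the subgroup, which gives the two closure properties for products.

For the counterexample, let `A` be the module of vectors of coordinate sum zero in `𝔽₃⁵`. The group
`A₅` permutes cyclically the three partitions into pairs of the complement of a point, and the
amounts of rotation form a crossed homomorphism `A₅ → A`. Pulling the resulting complement of `A` in
`A ⋊ A₅` back along reduction modulo three from `ℤ/9` yields an extension of `A₅` by `A` in which no
preimage of a 3-cycle has order three, so that it does not split. Since `A` is simple, it is a
Frattini extension. A 5-cycle acts without nonzero fixed points on `A`, and `A` extended by it is a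
non-nilpotent group of the kind above, whereas `A₅` has order not divisible by `3²`.
-/

open Subgroup

section PrimeDivisors

variable {G : Type*} [Group G] {p : ℕ}

theorem isPGroup_iff_primeDivisors_subset [Finite G] (hp : p.Prime) :
    IsPGroup p G ↔ primeDivisors G ⊆ {p} := by
  rw [isPGroup_iff_primeFactors_card_subset hp.ne_zero, hp.primeFactors]
  simp only [Finset.subset_iff, Nat.mem_primeFactors, Finset.mem_singleton, Set.subset_def,
    Set.mem_singleton_iff, primeDivisors, Set.mem_ofPred_eq]
  exact forall_congr' fun r => ⟨fun h hr => h ⟨hr.1, hr.2, Nat.card_pos.ne'⟩,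
    fun h hr => h ⟨hr.1, hr.2.1⟩⟩

theorem primeDivisors_eq_union (N : Subgroup G) [N.Normal] :
    primeDivisors G = primeDivisors N ∪ primeDivisors (G ⧸ N) := by
  ext r
  simp only [primeDivisors, Set.mem_ofPred_eq, Set.mem_union, ← and_or_left,
    card_eq_card_quotient_mul_card_subgroup N]
  exact and_congr_right fun hr => by rw [hr.dvd_mul, or_comm]

theorem isNilpotent_of_primeDivisors_subset [Finite G] (hp : p.Prime) (h : primeDivisors G ⊆ {p}) :
    Group.IsNilpotent G :=
  have := Fact.mk hp
  ((isPGroup_iff_primeDivisors_subset hp).2 h).isNilpotent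

end PrimeDivisors

theorem isPGroup_quotient_iff {G : Type*} [Group G] {q : ℕ} (N : Subgroup G) [N.Normal] :
    IsPGroup q (G ⧸ N) ↔ ∀ g : G, ∃ k : ℕ, g ^ q ^ k ∈ N := by
  refine (QuotientGroup.mk_surjective (s := N)).forall.trans (forall_congr' fun g => ?_)
  simp only [← QuotientGroup.mk_pow, QuotientGroup.eq_one_iff]

theorem map_eq_top_iff_sup_ker_eq_top {G H : Type*} [Group G] [Group H] {f : G →* H}
    (hf : Function.Surjective f) (U : Subgroup G) : U.map f = ⊤ ↔ U ⊔ f.ker = ⊤ := by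
  rw [← comap_map_eq, ← (comap_injective hf).eq_iff, comap_top]

theorem sup_eq_top_iff_isPGroup_quotient {G : Type*} [Group G] [Finite G] {q : ℕ}
    [Fact q.Prime] (N : Subgroup G) [N.Normal] (Q : Sylow q G) :
    N ⊔ Q = ⊤ ↔ IsPGroup q (G ⧸ N) := by
  have hmk : Function.Surjective (QuotientGroup.mk' N) := QuotientGroup.mk'_surjective N
  let Q' : Sylow q (G ⧸ N) := Q.mapSurjective hmk
  have hsup : N ⊔ Q = ⊤ ↔ (Q' : Subgroup (G ⧸ N)) = ⊤ := by
    rw [Sylow.coe_mapSurjective, map_eq_top_iff_sup_ker_eq_top hmk, QuotientGroup.ker_mk', sup_comm]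
  rw [hsup]
  refine ⟨fun h => (h ▸ Q'.2 : IsPGroup q (⊤ : Subgroup (G ⧸ N))).of_equiv topEquiv, fun h => ?_⟩
  exact (Q'.3 (h.to_subgroup ⊤) le_top).symm

/-! ### The Frattini subgroup -/

section Frattini

variable {G H : Type*} [Group G] [Group H]

theorem ker_le_frattini_iff [IsCoatomic (Subgroup G)] {f : G →* H}
    (hf : Function.Surjective f) :
    f.ker ≤ frattini G ↔ ∀ U : Subgroup G, U.map f = ⊤ → U = ⊤ := by
  simp only [map_eq_top_iff_sup_ker_eq_top hf]
  refine ⟨fun h U hU => frattini_nongenerating (eq_top_mono (sup_le_sup_left h U) hU),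
    fun h => le_iInf₂ fun M hM => ?_⟩
  by_contra hle
  exact hM.1 (h M (hM.2 _ (left_lt_sup.2 hle)))

/-- A subgroup minimal among those mapped onto `H` lifts `H` to a Frattini extension. -/
theorem exists_subgroupMap_surjective_ker_le_frattini [Finite G] {f : G →* H}
    (hf : Function.Surjective f) :
    ∃ T : Subgroup G, Function.Surjective (f.comp T.subtype) ∧
      (f.comp T.subtype).ker ≤ frattini T := by
  obtain ⟨T, -, hT⟩ := exists_minimal_le_of_wellFoundedLT
    (fun U : Subgroup G => U.map f = ⊤) ⊤ (map_top_of_surjective f hf)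
  have hsurj : Function.Surjective (f.comp T.subtype) := by
    rw [← MonoidHom.range_eq_top, MonoidHom.range_comp, range_subtype, hT.prop]
  refine ⟨T, hsurj, (ker_le_frattini_iff hsurj).2 fun U hU => ?_⟩
  rw [← map_map] at hU
  have hle : T ≤ U.map T.subtype := hT.le_of_le hU (map_subtype_le U)
  exact map_injective T.subtype_injective (by
    rw [← MonoidHom.range_eq_map, range_subtype]
    exact (map_subtype_le U).antisymm hle)

theorem frattini_eq_bot_of_isSimpleGroup [IsCoatomic (Subgroup G)] [IsSimpleGroup G] :
    frattini G = ⊥ := by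
  refine (Normal.eq_bot_or_eq_top inferInstance).resolve_right fun h => ?_
  exact bot_ne_top (frattini_nongenerating (K := (⊥ : Subgroup G)) (by rw [h, sup_top_eq]))

end Frattini

theorem isNilpotent_of_injective {G H : Type*} [Group G] [Group H] [Group.IsNilpotent G]
    (f : H →* G) (hf : Function.Injective f) : Group.IsNilpotent H :=
  Group.nilpotent_of_mulEquiv (f.ofInjective hf).symm

/-! ### Extensions of `p`-groups by `q`-groups -/

/-- `G` is an extension of a `p`-group by a `q`-group: the groups of order `pᵃqᵇ` with a normal
Sylow `p`-subgroup, when `G` is finite and `p ≠ q` are primes. The Schmidt `(p, q)`-groups are the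
Schmidt groups of this kind, and, unlike being a Schmidt group, the property passes to subgroups,
quotients and Frattini extensions. -/
def IsPByQ (p q : ℕ) (G : Type*) [Group G] : Prop :=
  ∃ P : Subgroup G, ∃ _ : P.Normal, IsPGroup p P ∧ IsPGroup q (G ⧸ P)

namespace IsPByQ

variable {p q : ℕ} {G H : Type*} [Group G] [Group H]

theorem of_injective (h : IsPByQ p q G) (f : H →* G) (hf : Function.Injective f) :
    IsPByQ p q H := by
  obtain ⟨P, _, hP, hQ⟩ := h
  rw [isPGroup_quotient_iff] at hQ
  refine ⟨P.comap f, inferInstance, hP.comap_of_injective f hf,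
    (isPGroup_quotient_iff _).2 fun x => ?_⟩
  obtain ⟨k, hk⟩ := hQ (f x)
  exact ⟨k, by rwa [mem_comap, map_pow]⟩

theorem of_surjective (h : IsPByQ p q G) (f : G →* H) (hf : Function.Surjective f) :
    IsPByQ p q H := by
  obtain ⟨P, hPn, hP, hQ⟩ := h
  rw [isPGroup_quotient_iff] at hQ
  have := hPn.map f hf
  refine ⟨P.map f, this, hP.map f, (isPGroup_quotient_iff _).2 (hf.forall.2 fun x => ?_)⟩
  obtain ⟨k, hk⟩ := hQ x
  exact ⟨k, by rw [← map_pow]; exact mem_map_of_mem f hk⟩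

variable [Finite G]

theorem primeDivisors_subset (hp : p.Prime) (hq : q.Prime) (h : IsPByQ p q G) :
    primeDivisors G ⊆ {p, q} := by
  obtain ⟨P, _, hP, hQ⟩ := h
  rw [primeDivisors_eq_union P]
  exact Set.union_subset_union ((isPGroup_iff_primeDivisors_subset hp).1 hP)
    ((isPGroup_iff_primeDivisors_subset hq).1 hQ)

theorem exists_sylow [Fact p.Prime] [hq : Fact q.Prime] (hpq : p ≠ q) (h : IsPByQ p q G) :
    ∃ P : Sylow p G, ∃ _ : (P : Subgroup G).Normal, IsPGroup q (G ⧸ (P : Subgroup G)) := by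
  obtain ⟨P, hPn, hP, hQ⟩ := h
  have hindex : ¬ p ∣ P.index := fun hd =>
    hpq ((isPGroup_iff_primeDivisors_subset hq.out).1 hQ ⟨Fact.out, hd⟩)
  exact ⟨hP.toSylow hindex, hPn, hQ⟩

/-- Frattini's argument: the normalizer of a Sylow `p`-subgroup `P` of `G` is mapped onto `H`. -/
theorem of_ker_le_frattini [Fact p.Prime] [Fact q.Prime] (hpq : p ≠ q) {f : G →* H}
    (hf : Function.Surjective f) (hker : f.ker ≤ frattini G) (h : IsPByQ p q H) :
    IsPByQ p q G := by
  have := Finite.of_surjective f hf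
  obtain ⟨P', hP'n, hQ'⟩ := h.exists_sylow hpq
  have := Sylow.unique_of_normal P' hP'n
  rw [ker_le_frattini_iff hf] at hker
  obtain ⟨P⟩ : Nonempty (Sylow p G) := inferInstance
  obtain ⟨Q⟩ : Nonempty (Sylow q G) := inferInstance
  have hmap : (P : Subgroup G).map f = P' := by
    rw [← Sylow.coe_mapSurjective hf, Subsingleton.elim (P.mapSurjective hf) P']
  have hPn : (P : Subgroup G).Normal := by
    refine normalizer_eq_top_iff.1 (hker _ ?_)
    have hsup := P.normalizer_sup_eq_top' (map_le_iff_le_comap.1 hmap.le)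
    have hsup' := congrArg (Subgroup.map f) hsup
    rw [Subgroup.map_sup, map_comap_eq_self_of_surjective hf, map_top_of_surjective f hf,
      ← hmap, ← Subgroup.map_sup, ← P.coe_coe, sup_eq_left.2 le_normalizer] at hsup'
    exact hsup'
  refine ⟨P, hPn, P.2, (sup_eq_top_iff_isPGroup_quotient _ Q).1 (hker _ ?_)⟩
  rw [Subgroup.map_sup, hmap, ← Sylow.coe_mapSurjective hf]
  exact (sup_eq_top_iff_isPGroup_quotient _ _).2 hQ'

theorem isNilpotent_of_swap [Fact p.Prime] [Fact q.Prime] (hpq : p ≠ q)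
    (h : IsPByQ p q G) (h' : IsPByQ q p G) : Group.IsNilpotent G := by
  obtain ⟨P, _, hP, hGP⟩ := h
  obtain ⟨Q, _, hQ, hGQ⟩ := h'
  have := hGP.isNilpotent
  have := hGQ.isNilpotent
  refine isNilpotent_of_injective ((QuotientGroup.mk' P).prod (QuotientGroup.mk' Q)) ?_
  rw [← MonoidHom.ker_eq_bot_iff, MonoidHom.ker_prod, QuotientGroup.ker_mk',
    QuotientGroup.ker_mk', (hP.disjoint_of_ne p q hpq P Q hQ).eq_bot]

/-- The number of Sylow `q`-subgroups divides `p` and is congruent to `1` modulo `q > p`. -/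
theorem swap_of_not_sq_dvd_card [hp : Fact p.Prime] [hq : Fact q.Prime] (hpq : p < q)
    (h : IsPByQ p q G) (hcard : ¬ p ^ 2 ∣ Nat.card G) : IsPByQ q p G := by
  obtain ⟨P, _, hP, hGP⟩ := h
  obtain ⟨Q⟩ : Nonempty (Sylow q G) := inferInstance
  obtain ⟨n, hn⟩ := IsPGroup.iff_card.1 hP
  have hindexP : (Q : Subgroup G).index ∣ Nat.card P := by
    have hindex : P.index ∣ Nat.card Q := by
      rw [← relIndex_top_right, ← (sup_eq_top_iff_isPGroup_quotient P Q).2 hGP, relIndex_sup_left]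
      exact relIndex_dvd_card _ _
    refine Nat.dvd_of_mul_dvd_mul_left (Nat.card_pos (α := Q)) ?_
    rw [card_mul_index, ← P.index_mul_card]
    exact Nat.mul_dvd_mul_right hindex _
  have hn1 : n ≤ 1 := by
    by_contra! hn2
    exact hcard ((pow_dvd_pow p hn2).trans (hn ▸ P.card_subgroup_dvd_card))
  have hindex : (Q : Subgroup G).index ∣ p :=
    (hn ▸ hindexP).trans ((pow_dvd_pow p hn1).trans (pow_one p).dvd)
  have hSylow : Nat.card (Sylow q G) = 1 := by
    have hdvd : Nat.card (Sylow q G) ∣ p := Q.card_dvd_index.trans hindex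
    refine (hp.out.eq_one_or_self_of_dvd _ hdvd).resolve_right fun h => ?_
    have hmod := h ▸ card_sylow_modEq_one q G
    exact hp.out.one_lt.ne' (hmod.eq_of_lt_of_lt hpq hq.out.one_lt)
  have := (Nat.card_eq_one_iff_unique.1 hSylow).1
  exact ⟨Q, Q.normal_of_subsingleton, Q.2, IsPGroup.of_card_dvd_pow (n := n) (hn ▸ hindexP)⟩

end IsPByQ

/-! ### Schmidt subgroups -/

section Schmidt

variable {p q : ℕ} {G H : Type*} [Group G] [Group H]

theorem isSchmidtPQ_iff [Finite G] :
    IsSchmidtPQ p q G ↔ IsSchmidt G ∧ p.Prime ∧ q.Prime ∧ p ≠ q ∧ IsPByQ p q G := by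
  refine and_congr_right fun hG => ⟨fun ⟨hπ, P, hP⟩ => ?_, fun ⟨hp, hq, hpq, h⟩ => ⟨?_, ?_⟩⟩
  · obtain ⟨hp, -⟩ : p ∈ primeDivisors G := hπ ▸ Set.mem_insert p {q}
    obtain ⟨hq, -⟩ : q ∈ primeDivisors G := hπ ▸ Set.mem_insert_of_mem p rfl
    have := Fact.mk hp
    refine ⟨hp, hq, ?_, P, hP, P.2, (isPGroup_iff_primeDivisors_subset hq).2 fun r hr => ?_⟩
    · rintro rfl
      exact hG.1 (isNilpotent_of_primeDivisors_subset hp (by rw [hπ, Set.pair_eq_singleton]))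
    · have hrG : r ∈ primeDivisors G := primeDivisors_eq_union (P : Subgroup G) ▸ Or.inr hr
      rw [hπ] at hrG
      exact hrG.resolve_left (by rintro rfl; exact P.not_dvd_index hr.2)
  · have hsub := h.primeDivisors_subset hp hq
    refine hsub.antisymm (Set.pair_subset ?_ ?_) <;> by_contra hmem
    · exact hG.1 (isNilpotent_of_primeDivisors_subset hq
        ((Set.subset_insert_iff_of_notMem hmem).1 hsub))
    · rw [Set.pair_comm] at hsub
      exact hG.1 (isNilpotent_of_primeDivisors_subset hp
        ((Set.subset_insert_iff_of_notMem hmem).1 hsub))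
  · have := Fact.mk hp
    have := Fact.mk hq
    exact (h.exists_sylow hpq).imp fun P hP => hP.1

theorem exists_isSchmidt_le [Finite G] {H : Subgroup G} (hH : ¬ Group.IsNilpotent H) :
    ∃ K ≤ H, IsSchmidt K := by
  obtain ⟨K, hKH, hK⟩ := exists_minimal_le_of_wellFoundedLT
    (fun K : Subgroup G => ¬ Group.IsNilpotent K) H hH
  refine ⟨K, hKH, hK.prop, fun L hL => ?_⟩
  have hlt : L.map K.subtype < K := (map_subtype_le L).lt_of_ne fun h => hL <|
    map_injective K.subtype_injective (by rw [h, ← MonoidHom.range_eq_map, range_subtype])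
  have := not_not.1 (hK.not_prop_of_lt hlt)
  exact Group.nilpotent_of_mulEquiv (L.equivMapOfInjective _ K.subtype_injective).symm

theorem hasSchmidtSubgroup_iff [Finite G] :
    HasSchmidtSubgroup p q G ↔ p.Prime ∧ q.Prime ∧ p ≠ q ∧
      ∃ H : Subgroup G, IsPByQ p q H ∧ ¬ Group.IsNilpotent H := by
  simp only [HasSchmidtSubgroup, isSchmidtPQ_iff]
  constructor
  · rintro ⟨H, hH, hp, hq, hpq, h⟩
    exact ⟨hp, hq, hpq, H, h, hH.1⟩
  · rintro ⟨hp, hq, hpq, H, h, hH⟩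
    obtain ⟨K, hKH, hK⟩ := exists_isSchmidt_le hH
    exact ⟨K, hK, hp, hq, hpq, h.of_injective (inclusion hKH) (inclusion_injective hKH)⟩

theorem IsPByQ.hasSchmidtSubgroup [Finite G] (hp : p.Prime) (hq : q.Prime) (hpq : p ≠ q)
    (h : IsPByQ p q H) (hH : ¬ Group.IsNilpotent H) (f : H →* G) (hf : Function.Injective f) :
    HasSchmidtSubgroup p q G :=
  hasSchmidtSubgroup_iff.2 ⟨hp, hq, hpq, f.range,
    h.of_surjective f.rangeRestrict f.rangeRestrict_surjective,
    fun _ => hH (isNilpotent_of_injective f.rangeRestrict (f.rangeRestrict_injective_iff.2 hf))⟩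

theorem HasSchmidtSubgroup.of_injective [Finite G] (h : HasSchmidtSubgroup p q H) (f : H →* G)
    (hf : Function.Injective f) : HasSchmidtSubgroup p q G := by
  have := Finite.of_injective f hf
  obtain ⟨hp, hq, hpq, K, hK, hKn⟩ := hasSchmidtSubgroup_iff.1 h
  exact hK.hasSchmidtSubgroup hp hq hpq hKn (f.comp K.subtype) (hf.comp K.subtype_injective)

theorem HasSchmidtSubgroup.of_surjective [Finite G] (h : HasSchmidtSubgroup p q H) (f : G →* H)
    (hf : Function.Surjective f) : HasSchmidtSubgroup p q G := by
  have := Finite.of_surjective f hf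
  obtain ⟨hp, hq, hpq, K, hK, hKn⟩ := hasSchmidtSubgroup_iff.1 h
  have := Fact.mk hp
  have := Fact.mk hq
  obtain ⟨T, hT, hker⟩ := exists_subgroupMap_surjective_ker_le_frattini
    (f.subgroupComap_surjective_of_surjective K hf)
  refine (IsPByQ.of_ker_le_frattini hpq hT hker hK).hasSchmidtSubgroup hp hq hpq
    (fun _ => hKn (Group.nilpotent_of_surjective _ hT)) ((K.comap f).subtype.comp T.subtype)
    ((K.comap f).subtype_injective.comp T.subtype_injective)

theorem HasSchmidtSubgroup.sq_dvd_card [Finite G] (hpq : p < q) (h : HasSchmidtSubgroup p q G) :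
    p ^ 2 ∣ Nat.card G := by
  obtain ⟨hp, hq, -, H, hH, hHn⟩ := hasSchmidtSubgroup_iff.1 h
  have := Fact.mk hp
  have := Fact.mk hq
  by_contra hcard
  exact hHn (hH.isNilpotent_of_swap hpq.ne
    (hH.swap_of_not_sq_dvd_card hpq (mt (·.trans H.card_subgroup_dvd_card) hcard)))

end Schmidt

/-! ### Closure properties of the Schmidt graph -/

namespace NatDigraph

protected theorem le_antisymm {Γ₁ Γ₂ : NatDigraph} (h : Γ₁ ≤ Γ₂) (h' : Γ₂ ≤ Γ₁) : Γ₁ = Γ₂ :=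
  NatDigraph.ext (h.1.antisymm h'.1) (h.2.antisymm h'.2)

protected theorem union_le {ι : Type*} {Γ : ι → NatDigraph} {Γ' : NatDigraph} (h : ∀ i, Γ i ≤ Γ') :
    union Γ ≤ Γ' :=
  ⟨Set.iUnion_subset fun i => (h i).1, Set.iUnion_subset fun i => (h i).2⟩

end NatDigraph

section SchmidtGraph

variable {G H : Type*} [Group G] [Finite G] [Group H] [Finite H]

theorem schmidtGraph_le_of_injective (f : H →* G) (hf : Function.Injective f) :
    schmidtGraph H ≤ schmidtGraph G :=
  ⟨fun _ hr => ⟨hr.1, hr.2.trans (card_dvd_of_injective f hf)⟩, fun _ he => he.of_injective f hf⟩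

theorem schmidtGraph_le_of_surjective (f : G →* H) (hf : Function.Surjective f) :
    schmidtGraph H ≤ schmidtGraph G :=
  ⟨fun _ hr => ⟨hr.1, hr.2.trans (card_dvd_of_surjective f hf)⟩, fun _ he => he.of_surjective f hf⟩

theorem schmidtGraph_eq_of_mulEquiv (e : G ≃* H) : schmidtGraph G = schmidtGraph H :=
  NatDigraph.le_antisymm (schmidtGraph_le_of_injective e.toMonoidHom e.injective)
    (schmidtGraph_le_of_surjective e.toMonoidHom e.surjective)

theorem schmidtGraph_isArithmetic : schmidtGraph.{u}.IsArithmetic := by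
  refine ⟨fun G _ _ r hr => hr.2, fun G _ _ _ => ?_⟩
  have hverts : (schmidtGraph G).verts = ∅ :=
    Set.eq_empty_of_forall_notMem fun r hr => hr.1.one_lt.ne' <|
      Nat.dvd_one.1 (Nat.card_of_subsingleton (1 : G) ▸ hr.2)
  refine NatDigraph.ext hverts (Set.subset_empty_iff.1 fun e he => ?_)
  simpa only [hverts, Set.empty_prod] using (schmidtGraph G).edges_subset he

theorem schmidtGraph_sClosed : schmidtGraph.{u}.SClosed := fun _ _ _ H =>
  schmidtGraph_le_of_injective H.subtype H.subtype_injective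

theorem schmidtGraph_qClosed : schmidtGraph.{u}.QClosed := fun _ _ _ N _ =>
  schmidtGraph_le_of_surjective (QuotientGroup.mk' N) (QuotientGroup.mk'_surjective N)

theorem HasSchmidtSubgroup.exists_of_pi {ι : Type*} {G : ι → Type*} [∀ i, Group (G i)]
    [Finite ι] [∀ i, Finite (G i)] {p q : ℕ} (h : HasSchmidtSubgroup p q (∀ i, G i)) :
    ∃ i, HasSchmidtSubgroup p q (G i) := by
  obtain ⟨hp, hq, hpq, H, hH, hHn⟩ := hasSchmidtSubgroup_iff.1 h
  let f (i : ι) : H →* G i := (Pi.evalMonoidHom G i).comp H.subtype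
  by_contra! hcon
  have hnil (i : ι) : Group.IsNilpotent (f i).range := by
    by_contra hn
    exact hcon i (hasSchmidtSubgroup_iff.2 ⟨hp, hq, hpq, (f i).range,
      hH.of_surjective (f i).rangeRestrict (f i).rangeRestrict_surjective, hn⟩)
  refine hHn (isNilpotent_of_injective (MonoidHom.pi fun i => (f i).rangeRestrict)
    fun x y hxy => Subtype.ext (funext fun i => ?_))
  exact congrArg Subtype.val (congrFun hxy i)

theorem schmidtGraph_pi {ι : Type*} [Finite ι] (G : ι → Type*) [∀ i, Group (G i)]
    [∀ i, Finite (G i)] :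
    schmidtGraph (∀ i, G i) = NatDigraph.union fun i => schmidtGraph (G i) := by
  have := Fintype.ofFinite ι
  refine NatDigraph.le_antisymm ⟨fun r ⟨hr, hd⟩ => ?_, fun e he => ?_⟩
    (NatDigraph.union_le fun i => schmidtGraph_le_of_surjective (Pi.evalMonoidHom G i)
      (Function.surjective_eval i))
  · rw [Nat.card_pi, Prime.dvd_finsetProd_iff hr.prime] at hd
    obtain ⟨i, -, hi⟩ := hd
    exact Set.mem_iUnion.2 ⟨i, hr, hi⟩
  · exact Set.mem_iUnion.2 (HasSchmidtSubgroup.exists_of_pi he)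

theorem schmidtGraph_d0Closed : schmidtGraph.{u}.D0Closed := fun _ G _ _ => schmidtGraph_pi G

theorem schmidtGraph_r0Closed : schmidtGraph.{u}.R0Closed := by
  intro G _ _ n N hN
  have : (⨅ i, N i).Normal := normal_iInf_normal hN
  let f (i : Fin n) : G ⧸ ⨅ i, N i →* G ⧸ N i :=
    QuotientGroup.map _ (N i) (MonoidHom.id G) (iInf_le N i)
  have hf (i : Fin n) : Function.Surjective (f i) :=
    QuotientGroup.map_surjective_of_surjective _ _ _ (QuotientGroup.mk_surjective) _
  refine NatDigraph.le_antisymm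
    (NatDigraph.union_le fun i => schmidtGraph_le_of_surjective (f i) (hf i)) ?_
  rw [← schmidtGraph_pi]
  refine schmidtGraph_le_of_injective (MonoidHom.pi f) ((injective_iff_map_eq_one _).2 ?_)
  refine QuotientGroup.mk_surjective.forall.2 fun x hx => (QuotientGroup.eq_one_iff _).2 ?_
  exact mem_iInf.2 fun i => (QuotientGroup.eq_one_iff _).1 (congrFun hx i)

end SchmidtGraph

/-! ### Extensions by modules in characteristic `p` -/

theorem le_center_of_isPGroup_of_isPGroup_quotient {G : Type*} [Group G] [Finite G]
    [Group.IsNilpotent G] {p q : ℕ} [Fact p.Prime] [Fact q.Prime] (hpq : p ≠ q) {P : Subgroup G}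
    [P.Normal] [IsMulCommutative P] (hP : IsPGroup p P) (hGP : IsPGroup q (G ⧸ P)) :
    P ≤ center G := by
  obtain ⟨Q⟩ : Nonempty (Sylow q G) := inferInstance
  have hQn : (Q : Subgroup G).Normal := inferInstance
  have hdisj : Disjoint P Q := hP.disjoint_of_ne p q hpq P Q Q.2
  intro x hx
  refine mem_center_iff.2 fun g => ?_
  have hg : g ∈ P ⊔ Q := (sup_eq_top_iff_isPGroup_quotient P Q).2 hGP ▸ mem_top g
  obtain ⟨y, hy, z, hz, rfl⟩ := mem_sup_of_normal_left.1 hg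
  have hyx : Commute y x := setLike_mul_comm hy hx
  have hzx : Commute z x := (commute_of_normal_of_disjoint P Q ‹_› hQn hdisj x z hx hz).symm
  exact hyx.mul_left hzx

theorem hasSchmidtSubgroup_of_not_commute {G R : Type*} [Group G] [Group R] [Finite R] {p q k : ℕ}
    [hp : Fact p.Prime] [hq : Fact q.Prime] (hpq : p ≠ q) {f : R →* G} [IsMulCommutative f.ker]
    (hker : IsPGroup p f.ker) {r x : R} (hr : f r ^ q ^ k = 1) (hx : f x = 1)
    (hrx : ¬ Commute r x) : HasSchmidtSubgroup p q R := by
  let H : Subgroup R := (zpowers (f r)).comap f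
  let P : Subgroup H := f.ker.subgroupOf H
  have hP : IsPGroup p P := hker.comap_subtype
  have hHP : IsPGroup q (H ⧸ P) := (isPGroup_quotient_iff P).2 fun y => ⟨k, by
    obtain ⟨i, hi⟩ := mem_zpowers_iff.1 y.2
    change f (y ^ q ^ k) = 1
    rw [map_pow, ← hi, ← zpow_natCast, zpow_comm, zpow_natCast, hr, one_zpow]⟩
  refine IsPByQ.hasSchmidtSubgroup hp.out hq.out hpq ⟨P, inferInstance, hP, hHP⟩
    (fun _ => hrx ?_) H.subtype H.subtype_injective
  let y : H := ⟨x, by rw [mem_comap, hx]; exact one_mem _⟩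
  have hy : y ∈ center H := le_center_of_isPGroup_of_isPGroup_quotient hpq hP hHP hx
  exact congrArg Subtype.val (mem_center_iff.1 hy ⟨r, mem_zpowers _⟩)

namespace IsFrattiniExtension

variable {K G A R : Type*} [Field K] [Group G] [AddCommGroup A] [Module K A] [Group R]
  {ρ : Representation K G A} {S : GroupExtension (Multiplicative A) R G}

theorem range_inl_eq_frattini (h : IsFrattiniExtension ρ S) (hG : frattini G = ⊥) :
    S.inl.range = frattini R := by
  refine h.range_le_frattini.antisymm ?_
  have hle := frattini_le_comap_frattini_of_surjective S.rightHom_surjective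
  rwa [hG, MonoidHom.comap_bot, ← S.range_inl_eq_ker_rightHom] at hle

theorem nonempty_quotient_frattini_mulEquiv (h : IsFrattiniExtension ρ S) (hG : frattini G = ⊥) :
    Nonempty (R ⧸ frattini R ≃* G) :=
  ⟨(QuotientGroup.quotientMulEquivOfEq (h.range_inl_eq_frattini hG).symm).trans
    S.quotientRangeInlEquivRight⟩

end IsFrattiniExtension

section ModuleExtension

variable {p : ℕ} [Fact p.Prime] {G A R : Type*} [Group G] [AddCommGroup A] [Module (ZMod p) A]
  [Group R] {ρ : Representation (ZMod p) G A} {S : GroupExtension (Multiplicative A) R G}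

/-- If `M` maps onto `G`, then `M ∩ A` is a submodule of the simple module `A`, and it is not zero,
since otherwise `M` is a complement to `A` and the order of `g` is preserved in it. -/
theorem isFrattiniExtension_of_pow_ne_one [Finite R] [ρ.IsIrreducible]
    (hconj : ∀ (r : R) (a : A), r * S.inl (Multiplicative.ofAdd a) * r⁻¹ =
      S.inl (Multiplicative.ofAdd (ρ (S.rightHom r) a)))
    {g : G} {n : ℕ} (hg : g ^ n = 1) (hpow : ∀ r, S.rightHom r = g → r ^ n ≠ 1) :
    IsFrattiniExtension ρ S := by
  have hsurj := S.rightHom_surjective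
  refine ⟨hconj, ?_⟩
  rw [S.range_inl_eq_ker_rightHom, ker_le_frattini_iff hsurj]
  intro M hM
  have hlift (h : G) : ∃ m ∈ M, S.rightHom m = h := (hM ▸ mem_top h : h ∈ M.map S.rightHom)
  let W : Subrepresentation ρ :=
    { toSubmodule := AddSubgroup.toZModSubmodule p (toAddSubgroup' (M.comap S.inl))
      apply_mem_toSubmodule := by
        intro h a ha
        obtain ⟨m, hm, rfl⟩ := hlift h
        change S.inl (Multiplicative.ofAdd (ρ (S.rightHom m) a)) ∈ M
        rw [← hconj]
        exact M.mul_mem (M.mul_mem hm ha) (M.inv_mem hm) }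
  have hW (a : A) : a ∈ W ↔ S.inl (Multiplicative.ofAdd a) ∈ M := Iff.rfl
  obtain ⟨m, hm, hmg⟩ := hlift g
  obtain ⟨a, ha⟩ : m ^ n ∈ S.inl.range := by
    rw [S.range_inl_eq_ker_rightHom, MonoidHom.mem_ker, map_pow, hmg, hg]
  rcases eq_bot_or_eq_top W with hbot | htop
  · have haW : a.toAdd ∈ W := (hW _).2 (ha ▸ M.pow_mem hm n)
    rw [hbot] at haW
    have ha1 : a = 1 := haW
    exact absurd (ha.symm.trans (by rw [ha1, map_one])) (hpow m hmg)
  · rw [← sup_eq_left.2 (_ : S.rightHom.ker ≤ M), ← map_eq_top_iff_sup_ker_eq_top hsurj, hM]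
    rw [← S.range_inl_eq_ker_rightHom]
    rintro _ ⟨b, rfl⟩
    exact (hW b.toAdd).1 (htop ▸ trivial)

theorem hasSchmidtSubgroup_of_groupExtension [Finite R] {q : ℕ} [Fact q.Prime] (hpq : p ≠ q)
    (hconj : ∀ (r : R) (a : A), r * S.inl (Multiplicative.ofAdd a) * r⁻¹ =
      S.inl (Multiplicative.ofAdd (ρ (S.rightHom r) a)))
    {g : G} {k : ℕ} (hg : g ^ q ^ k = 1) (hρ : ρ g ≠ 1) : HasSchmidtSubgroup p q R := by
  obtain ⟨r, rfl⟩ := S.rightHom_surjective g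
  obtain ⟨a, ha⟩ : ∃ a, ρ (S.rightHom r) a ≠ a := by
    by_contra! h
    exact hρ (LinearMap.ext h)
  have hA : IsPGroup p (Multiplicative A) := fun a => ⟨1, by
    rw [pow_one, ← ofAdd_toAdd a, ← ofAdd_nsmul, ZModModule.char_nsmul_eq_zero, ofAdd_zero]⟩
  have hcomm : IsMulCommutative S.rightHom.ker := S.range_inl_eq_ker_rightHom ▸ inferInstance
  have hker : IsPGroup p S.rightHom.ker := by
    rw [← S.range_inl_eq_ker_rightHom]
    exact hA.of_surjective S.inl.rangeRestrict S.inl.rangeRestrict_surjective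
  refine hasSchmidtSubgroup_of_not_commute hpq hker hg
    (S.rightHom_inl (Multiplicative.ofAdd a)) fun h => ha ?_
  exact S.inl_injective ((hconj r a).symm.trans (mul_inv_eq_iff_eq_mul.2 h))

end ModuleExtension

/-! ### Irreducibility from fixed-point-free automorphisms -/

section Representation

variable {G : Type*} [Group G] {q : ℕ} [Fact q.Prime] {g : G}

theorem card_modEq_one_of_fixedPointFree {k V : Type*} [Semiring k] [AddCommMonoid V] [Module k V]
    [Finite V] (ρ : Representation k G V) (hg : g ^ q = 1) (hfix : ∀ v, ρ g v = v → v = 0) :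
    Nat.card V ≡ 1 [MOD q] := by
  classical
  have := Fintype.ofFinite V
  let act : G →* Function.End V :=
    { toFun := fun h v => ρ h v
      map_one' := by rw [map_one]; rfl
      map_mul' := fun _ _ => by rw [map_mul]; rfl }
  have hpow : act g ^ q ^ 1 = 1 := by rw [← map_pow, pow_one, hg, map_one]
  have hcard : Fintype.card (act g).fixedPoints = 1 :=
    Fintype.card_eq_one_iff.2 ⟨⟨0, map_zero (ρ g)⟩, fun v => Subtype.ext (hfix v v.2)⟩
  rw [Nat.card_eq_fintype_card, ← hcard]
  exact Equiv.Perm.card_fixedPoints_modEq hpow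

/-- A subrepresentation `W` of dimension `d` has `p ^ d ≡ 1` elements modulo `q`. -/
theorem isIrreducible_of_fixedPointFree {p : ℕ} [Fact p.Prime] {A : Type*} [AddCommGroup A]
    [Module (ZMod p) A] [Finite A] [Nontrivial A] (ρ : Representation (ZMod p) G A)
    (hg : g ^ q = 1) (hfix : ∀ a, ρ g a = a → a = 0)
    (hdim : Module.finrank (ZMod p) A ≤ orderOf (p : ZMod q)) : ρ.IsIrreducible where
  exists_pair_ne := ⟨⊥, ⊤, fun h => by
    obtain ⟨a, ha⟩ := exists_ne (0 : A)
    exact ha (show a ∈ (⊥ : Subrepresentation ρ) from h ▸ trivial)⟩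
  eq_bot_or_eq_top W := by
    have hcard : Nat.card W.toSubmodule ≡ 1 [MOD q] :=
      card_modEq_one_of_fixedPointFree W.toRepresentation hg fun w hw =>
        Subtype.ext (hfix w (congrArg Subtype.val hw))
    have hdvd : orderOf (p : ZMod q) ∣ Module.finrank (ZMod p) W.toSubmodule := by
      rw [Module.natCard_eq_pow_finrank (K := ZMod p), Nat.card_zmod,
        ← ZMod.natCast_eq_natCast_iff] at hcard
      exact orderOf_dvd_of_pow_eq_one (by exact_mod_cast hcard)
    rcases Nat.eq_zero_or_pos (Module.finrank (ZMod p) W.toSubmodule) with h0 | hpos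
    · exact Or.inl (Subrepresentation.toSubmodule_injective (Submodule.finrank_eq_zero.1 h0))
    · exact Or.inr (Subrepresentation.toSubmodule_injective (Submodule.eq_top_of_finrank_eq
        (W.toSubmodule.finrank_le.antisymm (hdim.trans (Nat.le_of_dvd hpos hdvd)))))

theorem injective_of_isSimpleGroup [IsSimpleGroup G] {k V : Type*} [Semiring k] [AddCommMonoid V]
    [Module k V] {ρ : Representation k G V} (hρ : ρ g ≠ 1) : Function.Injective ρ := by
  have hker : (ρ.ker).Normal := inferInstance
  refine (MonoidHom.ker_eq_bot_iff ρ).1 (hker.eq_bot_or_eq_top.resolve_right fun h => hρ ?_)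
  exact MonoidHom.mem_ker.1 (h ▸ mem_top g)

end Representation

/-! ### Preimages of complements in semidirect products -/

section ComplementPreimage

variable {A N M G : Type*} [Group A] [Group N] [Group M] [Group G] {φ : G →* MulAut N}
  {ψ : G →* MulAut M} {π : N →* M} (hπ : ∀ g, π.comp (φ g).toMonoidHom = (ψ g).toMonoidHom.comp π)
  (s : G →* M ⋊[ψ] G)

/-- The preimage in `N ⋊ G` of the subgroup `s(G)` of `M ⋊ G`. When `s` is a section, `s(G)` is a
complement of `M`, and the preimage is an extension of `G` by the kernel of `π : N → M`. -/
def complementPreimage : Subgroup (N ⋊[φ] G) :=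
  s.range.comap (SemidirectProduct.map π (MonoidHom.id G) hπ)

variable {hπ s} (hs : SemidirectProduct.rightHom.comp s = MonoidHom.id G)

include hs in
theorem mem_complementPreimage {x : N ⋊[φ] G} :
    x ∈ complementPreimage hπ s ↔ π x.left = (s x.right).left := by
  have hright (g : G) : (s g).right = g := DFunLike.congr_fun hs g
  constructor
  · rintro ⟨g, hg⟩
    obtain rfl : g = x.right := by rw [← hright g, hg]; rfl
    rw [hg]; rfl
  · exact fun h => ⟨x.right, SemidirectProduct.ext h.symm (hright x.right)⟩

/-- The extension of `G` by `A = ker π` given by the preimage of a complement. -/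
def complementPreimageExtension (hsurj : Function.Surjective π) {j : A →* N}
    (hinj : Function.Injective j) (hj : j.range = π.ker) :
    GroupExtension A (complementPreimage hπ s) G where
  inl := (SemidirectProduct.inl.comp j).codRestrict _ fun a => by
    have ha : j a ∈ π.ker := hj ▸ ⟨a, rfl⟩
    rw [mem_complementPreimage hs]
    simpa using ha
  rightHom := SemidirectProduct.rightHom.comp (complementPreimage hπ s).subtype
  inl_injective _ _ h := hinj (SemidirectProduct.inl_injective (congrArg Subtype.val h))
  range_inl_eq_ker_rightHom := by
    ext ⟨x, hx⟩
    rw [mem_complementPreimage hs] at hx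
    constructor
    · rintro ⟨a, ha⟩
      exact congrArg (fun y => y.1.right) ha.symm
    · intro (hx1 : x.right = 1)
      obtain ⟨a, ha⟩ : x.left ∈ j.range := by
        rw [hj, MonoidHom.mem_ker, hx, hx1, map_one, SemidirectProduct.one_left]
      exact ⟨a, Subtype.ext (SemidirectProduct.ext ha hx1.symm)⟩
  rightHom_surjective g := by
    obtain ⟨n, hn⟩ := hsurj (s g).left
    exact ⟨⟨⟨n, g⟩, (mem_complementPreimage hs).2 hn⟩, rfl⟩

end ComplementPreimage

theorem complementPreimageExtension_conj_inl {A N M G : Type*} [Group A] [CommGroup N] [Group M]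
    [Group G] {φ : G →* MulAut N} {ψ : G →* MulAut M} {π : N →* M}
    {hπ : ∀ g, π.comp (φ g).toMonoidHom = (ψ g).toMonoidHom.comp π} {s : G →* M ⋊[ψ] G}
    (hs : SemidirectProduct.rightHom.comp s = MonoidHom.id G) (hsurj : Function.Surjective π)
    {j : A →* N} (hinj : Function.Injective j) (hj : j.range = π.ker) {χ : G →* MulAut A}
    (hχ : ∀ g a, j (χ g a) = φ g (j a)) (r : complementPreimage hπ s) (a : A) :
    r * (complementPreimageExtension hs hsurj hinj hj).inl a * r⁻¹ =
      (complementPreimageExtension hs hsurj hinj hj).inl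
        (χ ((complementPreimageExtension hs hsurj hinj hj).rightHom r) a) := by
  refine mul_inv_eq_iff_eq_mul.2 (Subtype.ext (SemidirectProduct.ext ?_ ?_))
  · change r.1.left * φ r.1.right (j a) = j (χ r.1.right a) * φ 1 r.1.left
    rw [hχ, map_one, MulAut.one_apply, mul_comm]
  · exact (mul_one _).trans (one_mul _).symm

/-! ### The deleted permutation module -/

section SumZero

variable (k : Type*) {l m G : Type*} (X : Type*) [Ring k] [Ring l] [Ring m] [Group G]
  [Fintype X] [MulAction G X]

/-- The vectors of coordinate sum zero in the permutation module `X → k`. -/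
def sumZero : Submodule k (X → k) := LinearMap.ker (∑ i, LinearMap.proj i)

variable {k X}

theorem mem_sumZero {v : X → k} : v ∈ sumZero k X ↔ ∑ i, v i = 0 := by
  simp [sumZero, LinearMap.mem_ker]

theorem finrank_sumZero_lt {K : Type*} [Field K] [Nonempty X] :
    Module.finrank K (sumZero K X) < Fintype.card X := by
  classical
  obtain ⟨i⟩ := ‹Nonempty X›
  refine (Submodule.finrank_lt fun h => ?_).trans_eq (Module.finrank_fintype_fun_eq_card K)
  have hi : Pi.single i 1 ∈ sumZero K X := h ▸ Submodule.mem_top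
  simp [mem_sumZero] at hi

instance [Nontrivial k] [Nontrivial X] : Nontrivial (sumZero k X) := by
  classical
  obtain ⟨i, j, hij⟩ := exists_pair_ne X
  refine ⟨⟨⟨Pi.single i 1 - Pi.single j 1, mem_sumZero.2 (by simp)⟩, 0, fun h => ?_⟩⟩
  simpa [hij] using congrFun (congrArg Subtype.val h) i

/-- The deleted permutation module: `G` permutes the coordinates of the vectors in `sumZero`. -/
def deletedPermutationRep : Representation k G (sumZero k X) where
  toFun g :=
    { toFun := fun v => ⟨fun i => v.1 (g⁻¹ • i), mem_sumZero.2 (by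
        exact ((MulAction.toPerm g⁻¹ : Equiv.Perm X).bijective.sum_comp v.1).trans
          (mem_sumZero.1 v.2))⟩
      map_add' := fun _ _ => rfl
      map_smul' := fun _ _ => rfl }
  map_one' := by ext v i; change v.1 ((1 : G)⁻¹ • i) = v.1 i; rw [inv_one, one_smul]
  map_mul' g h := by
    ext v i
    change v.1 ((g * h)⁻¹ • i) = v.1 (h⁻¹ • g⁻¹ • i)
    rw [mul_inv_rev, mul_smul]

theorem deletedPermutationRep_apply (g : G) (v : sumZero k X) (i : X) :
    (deletedPermutationRep g v).1 i = v.1 (g⁻¹ • i) := rfl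

theorem eq_zero_of_deletedPermutationRep_eq_self {g : G} (hg : ∀ i j : X, ∃ n : ℕ, g ^ n • i = j)
    (hX : IsUnit (Fintype.card X : k)) {v : sumZero k X} (hv : deletedPermutationRep g v = v) :
    v = 0 := by
  have hpow (n : ℕ) (i : X) : v.1 (g ^ n • i) = v.1 i := by
    induction n with
    | zero => rw [pow_zero, one_smul]
    | succ n ih =>
      rw [pow_succ', mul_smul, ← ih]
      nth_rewrite 1 [← hv]
      rw [deletedPermutationRep_apply, inv_smul_smul]
  ext i
  have hconst (j : X) : v.1 j = v.1 i := by
    obtain ⟨n, rfl⟩ := hg i j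
    exact hpow n i
  have hsum := mem_sumZero.1 v.2
  simp only [hconst, Finset.sum_const, Finset.card_univ, nsmul_eq_mul] at hsum
  exact hX.mul_right_eq_zero.1 hsum

/-- A homomorphism of coefficient groups, applied to the coordinates. -/
def sumZeroMap (X : Type*) [Fintype X] (f : k →+ l) : sumZero k X →+ sumZero l X where
  toFun v := ⟨fun i => f (v.1 i), mem_sumZero.2 (by rw [← map_sum, mem_sumZero.1 v.2, map_zero])⟩
  map_zero' := Subtype.ext (funext fun _ => map_zero f)
  map_add' _ _ := Subtype.ext (funext fun _ => map_add f _ _)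

theorem sumZeroMap_injective {f : k →+ l} (hf : Function.Injective f) :
    Function.Injective (sumZeroMap X f) := fun _ _ h =>
  Subtype.ext (funext fun i => hf (congrFun (congrArg Subtype.val h) i))

theorem sumZeroMap_surjective [Nonempty X] {f : k →+ l} (hf : Function.Surjective f) :
    Function.Surjective (sumZeroMap X f) := by
  classical
  obtain ⟨i₀⟩ := ‹Nonempty X›
  intro w
  choose v hv using fun i => hf (w.1 i)
  have hsum : f (∑ i, v i) = 0 := by simp only [map_sum, hv]; exact mem_sumZero.1 w.2
  refine ⟨⟨v - Pi.single i₀ (∑ i, v i), mem_sumZero.2 (by simp)⟩, Subtype.ext (funext fun i => ?_)⟩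
  change f (v i - (Pi.single i₀ (∑ i, v i) : X → k) i) = w.1 i
  rcases eq_or_ne i i₀ with rfl | hi
  · rw [Pi.single_eq_same, map_sub, hv, hsum, sub_zero]
  · rw [Pi.single_eq_of_ne hi, sub_zero, hv]

theorem sumZeroMap_range_eq_ker {f : k →+ l} {g : l →+ m} (hf : Function.Injective f)
    (hfg : f.range = g.ker) : (sumZeroMap X f).range = (sumZeroMap X g).ker := by
  have hmem (y : l) : g y = 0 ↔ ∃ x, f x = y := by
    rw [← AddMonoidHom.mem_ker, ← hfg, AddMonoidHom.mem_range]
  ext w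
  constructor
  · rintro ⟨v, rfl⟩
    exact Subtype.ext (funext fun i => (hmem _).2 ⟨v.1 i, rfl⟩)
  · intro hw
    choose v hv using fun i => (hmem (w.1 i)).1 (congrFun (congrArg Subtype.val hw) i)
    refine ⟨⟨v, mem_sumZero.2 (hf ?_)⟩, Subtype.ext (funext hv)⟩
    simp only [map_sum, hv, map_zero]
    exact mem_sumZero.1 w.2

end SumZero

section RepMulAut

variable {k V G : Type*} [Semiring k] [AddCommGroup V] [Module k V] [Group G]
  (ρ : Representation k G V)

/-- The action of `G` by automorphisms on the additive group of a representation. -/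
def repMulAut : G →* MulAut (Multiplicative V) where
  toFun g := AddEquiv.toMultiplicative
    { toFun := ρ g
      invFun := ρ g⁻¹
      left_inv := ρ.inv_self_apply g
      right_inv := ρ.self_inv_apply g
      map_add' := map_add (ρ g) }
  map_one' := by ext v; exact DFunLike.congr_fun (map_one ρ) v.toAdd
  map_mul' g h := by ext v; exact DFunLike.congr_fun (map_mul ρ g h) v.toAdd

variable {ρ}

/-- The section `g ↦ (c g, g)` of the split extension given by a crossed homomorphism `c`. -/
def crossedSection (c : G → V) (hc : ∀ g h, c (g * h) = c g + ρ g (c h)) :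
    G →* Multiplicative V ⋊[repMulAut ρ] G :=
  MonoidHom.mk' (fun g => ⟨Multiplicative.ofAdd (c g), g⟩) fun g h =>
    SemidirectProduct.ext (congrArg Multiplicative.ofAdd (hc g h)) rfl

end RepMulAut

theorem toAdd_left_pow_apply {k X G : Type*} [Ring k] [Fintype X] [Group G] [MulAction G X]
    (x : Multiplicative (sumZero k X) ⋊[repMulAut deletedPermutationRep] G) {i : X}
    (hi : x.right • i = i) (n : ℕ) : (x ^ n).left.toAdd.1 i = n • x.left.toAdd.1 i := by
  induction n with
  | zero => rw [pow_zero, zero_smul]; rfl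
  | succ n ih =>
    have hmul : (x * x ^ n).left.toAdd.1 i =
        x.left.toAdd.1 i + (x ^ n).left.toAdd.1 (x.right⁻¹ • i) := rfl
    rw [pow_succ', hmul, inv_smul_eq_iff.2 hi.symm, ih, succ_nsmul']

instance {N G : Type*} [Group N] [Group G] [Finite N] [Finite G] {φ : G →* MulAut N} :
    Finite (N ⋊[φ] G) :=
  Finite.of_equiv (N × G) SemidirectProduct.equivProd.symm

/-! ### The Frattini extension of `A₅` -/

local notation "A₅" => alternatingGroup (Fin 5)

/-- The cycle `i ↦ i + 1`. -/
def fiveCycle : A₅ := ⟨finRotate 5, by rw [Equiv.Perm.mem_alternatingGroup]; decide⟩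

/-- The cycle `(1 2 3)`. -/
def threeCycle : A₅ :=
  ⟨Equiv.swap 1 2 * Equiv.swap 2 3, by rw [Equiv.Perm.mem_alternatingGroup]; decide⟩

theorem fiveCycle_pow_five : fiveCycle ^ 5 = 1 := Subtype.ext (by decide)

theorem threeCycle_pow_three : threeCycle ^ 3 = 1 := Subtype.ext (by decide)

theorem exists_fiveCycle_pow_smul_eq (i j : Fin 5) : ∃ n : ℕ, fiveCycle ^ n • i = j :=
  ⟨(j - i).val, by revert i j; decide⟩

theorem fiveCycle_fixedPointFree {v : sumZero (ZMod 3) (Fin 5)}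
    (hv : deletedPermutationRep fiveCycle v = v) : v = 0 :=
  eq_zero_of_deletedPermutationRep_eq_self exists_fiveCycle_pow_smul_eq
    (by rw [Fintype.card_fin]; decide) hv

theorem deletedPermutationRep_fiveCycle_ne_one :
    deletedPermutationRep (k := ZMod 3) (X := Fin 5) fiveCycle ≠ 1 := fun h => by
  obtain ⟨v, hv⟩ := exists_ne (0 : sumZero (ZMod 3) (Fin 5))
  exact hv (fiveCycle_fixedPointFree (by rw [h]; rfl))

instance : Fact (Nat.Prime 5) := ⟨Nat.prime_five⟩

instance : (deletedPermutationRep (k := ZMod 3) (X := Fin 5) (G := A₅)).IsIrreducible := by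
  have horder : orderOf (3 : ZMod 5) = 2 ^ (1 + 1) :=
    orderOf_eq_prime_pow (by decide) (by decide)
  have hdim : Module.finrank (ZMod 3) (sumZero (ZMod 3) (Fin 5)) < 5 := finrank_sumZero_lt
  refine isIrreducible_of_fixedPointFree _ fiveCycle_pow_five (fun _ => fiveCycle_fixedPointFree) ?_
  exact (Nat.le_of_lt_succ hdim).trans_eq horder.symm

/-- The complement of `i` has three partitions into pairs, and `pairingLabel i a b` numbers the one
in which `a` and `b` are partners: if `{a - i, b - i}` is a part of `{1, 4}, {2, 3}`, of
`{1, 2}, {3, 4}` or of `{1, 3}, {2, 4}`, then `(a - i) * (b - i)` is `±1`, `2` or `3` modulo five.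
The point of the numbering is that even permutations preserve the cyclic order of the labels. -/
def pairingLabel (i a b : Fin 5) : ZMod 3 :=
  if (a - i) * (b - i) = 2 then 1 else if (a - i) * (b - i) = 3 then 2 else 0

/-- The amount by which an even permutation `σ` shifts the labels of the pairings of the complement
of `i`. It is computed from the pairing of `i + 1` with `i + 2`, which has label `1`. -/
def labelShift (σ : Equiv.Perm (Fin 5)) (i : Fin 5) : ZMod 3 :=
  pairingLabel (σ i) (σ (i + 1)) (σ (i + 2)) - 1

set_option maxRecDepth 100000 in
theorem pairingLabel_map_sub : ∀ σ : Equiv.Perm (Fin 5), Equiv.Perm.sign σ = 1 →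
    ∀ i a b : Fin 5, a ≠ i → b ≠ i → a ≠ b →
      pairingLabel (σ i) (σ a) (σ b) - pairingLabel i a b = labelShift σ i := by decide

set_option maxRecDepth 100000 in
theorem sum_labelShift : ∀ σ : Equiv.Perm (Fin 5), Equiv.Perm.sign σ = 1 →
    ∑ i, labelShift σ i = 0 := by decide

theorem labelShift_mul (σ τ : A₅) (i : Fin 5) :
    labelShift (σ * τ : A₅) i = labelShift σ (τ • i) + labelShift τ i := by
  have h := pairingLabel_map_sub σ σ.2 (τ.1 i) (τ.1 (i + 1)) (τ.1 (i + 2)) (by simp) (by simp)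
    (by simp)
  change _ = labelShift σ (τ.1 i) + _
  rw [← h]
  simp [labelShift]

/-- The crossed homomorphism `σ ↦ (labelShift σ (σ⁻¹ i))ᵢ`. -/
def labelCocycle (σ : A₅) : sumZero (ZMod 3) (Fin 5) :=
  ⟨fun i => labelShift σ (σ⁻¹ • i), mem_sumZero.2
    (((σ⁻¹ : A₅).1.bijective.sum_comp (labelShift σ)).trans (sum_labelShift σ σ.2))⟩

theorem labelCocycle_mul (σ τ : A₅) :
    labelCocycle (σ * τ) = labelCocycle σ + deletedPermutationRep σ (labelCocycle τ) := by
  ext i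
  change labelShift (σ * τ : A₅) ((σ * τ)⁻¹ • i) =
    labelShift σ (σ⁻¹ • i) + labelShift τ (τ⁻¹ • σ⁻¹ • i)
  rw [labelShift_mul, mul_inv_rev, mul_smul, smul_inv_smul]

/-- Reduction modulo three. -/
abbrev modThree : ZMod 9 →+ ZMod 3 := (ZMod.castHom (by norm_num) (ZMod 3)).toAddMonoidHom

/-- Multiplication by three, from `ℤ/3` to `ℤ/9`. -/
def timesThree : ZMod 3 →+ ZMod 9 := AddMonoidHom.mk' (fun x => 3 * (x.val : ZMod 9)) (by decide)

theorem timesThree_range_eq_ker : timesThree.range = modThree.ker := by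
  ext y
  revert y
  change ∀ y, (∃ x, timesThree x = y) ↔ modThree y = 0
  decide

/-- The preimage, in the semidirect product of `A₅` with the deleted permutation module over `ℤ/9`,
of the complement given by `labelCocycle` in the semidirect product over `ℤ/3`. -/
abbrev frattiniCover :
    Subgroup (Multiplicative (sumZero (ZMod 9) (Fin 5)) ⋊[repMulAut deletedPermutationRep] A₅) :=
  complementPreimage (π := (sumZeroMap (Fin 5) modThree).toMultiplicative) (fun _ => rfl)
    (crossedSection labelCocycle labelCocycle_mul)

/-- `frattiniCover` as an extension of `A₅`. The kernel of reduction modulo three is identified with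
the module over `ℤ/3` by multiplication by three. -/
def frattiniCoverExtension :
    GroupExtension (Multiplicative (sumZero (ZMod 3) (Fin 5))) frattiniCover A₅ :=
  complementPreimageExtension rfl (sumZeroMap_surjective (f := modThree) (by decide))
    (j := (sumZeroMap (Fin 5) timesThree).toMultiplicative)
    (sumZeroMap_injective (f := timesThree) (by decide))
    (congrArg AddSubgroup.toSubgroup
      (sumZeroMap_range_eq_ker (f := timesThree) (by decide) timesThree_range_eq_ker))

theorem frattiniCoverExtension_conj_inl (r : frattiniCover) (a : sumZero (ZMod 3) (Fin 5)) :
    r * frattiniCoverExtension.inl (Multiplicative.ofAdd a) * r⁻¹ =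
      frattiniCoverExtension.inl (Multiplicative.ofAdd
        (deletedPermutationRep (frattiniCoverExtension.rightHom r) a)) := by
  have hχ (g : A₅) (a : Multiplicative (sumZero (ZMod 3) (Fin 5))) :
      (sumZeroMap (Fin 5) timesThree).toMultiplicative (repMulAut deletedPermutationRep g a) =
        repMulAut deletedPermutationRep g
          ((sumZeroMap (Fin 5) timesThree).toMultiplicative a) := rfl
  exact complementPreimageExtension_conj_inl (π := (sumZeroMap (Fin 5) modThree).toMultiplicative)
    (hπ := fun _ => rfl) (s := crossedSection labelCocycle labelCocycle_mul) rfl _ _ _ hχ r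
    (Multiplicative.ofAdd a)

theorem three_nsmul_ne_zero {y : ZMod 9} (h : modThree y ≠ 0) : 3 • y ≠ 0 := by
  revert y
  decide

/-- The zeroth coordinate of `r` is a unit modulo nine, and is tripled in `r ^ 3`. -/
theorem frattiniCover_pow_three_ne_one {r : frattiniCover}
    (hr : frattiniCoverExtension.rightHom r = threeCycle) : r ^ 3 ≠ 1 := by
  intro h
  have hright : r.1.right = threeCycle := hr
  have hred : modThree (r.1.left.toAdd.1 0) = (labelCocycle threeCycle).1 0 := by
    have hleft := (mem_complementPreimage rfl).1 r.2
    rw [hright] at hleft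
    exact congrArg (fun v => v.toAdd.1 0) hleft
  have hunit : modThree (r.1.left.toAdd.1 0) ≠ 0 := by rw [hred]; decide
  refine three_nsmul_ne_zero hunit ?_
  rw [← toAdd_left_pow_apply r.1 (by rw [hright]; decide), ← coe_pow, h]
  rfl

theorem isFrattiniExtension_frattiniCover :
    IsFrattiniExtension deletedPermutationRep frattiniCoverExtension :=
  isFrattiniExtension_of_pow_ne_one frattiniCoverExtension_conj_inl threeCycle_pow_three
    fun _ => frattiniCover_pow_three_ne_one

theorem hasSchmidtSubgroup_frattiniCover : HasSchmidtSubgroup 3 5 frattiniCover :=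
  hasSchmidtSubgroup_of_groupExtension (k := 1) (by decide) frattiniCoverExtension_conj_inl
    fiveCycle_pow_five deletedPermutationRep_fiveCycle_ne_one

theorem not_hasSchmidtSubgroup_alternatingGroup : ¬ HasSchmidtSubgroup 3 5 A₅ := fun h => by
  have hdvd := h.sq_dvd_card (by decide)
  rw [nat_card_alternatingGroup, Nat.card_fin] at hdvd
  revert hdvd
  decide

theorem nonempty_quotient_frattini_frattiniCover_mulEquiv :
    Nonempty (frattiniCover ⧸ frattini frattiniCover ≃* A₅) :=
  isFrattiniExtension_frattiniCover.nonempty_quotient_frattini_mulEquiv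
    frattini_eq_bot_of_isSimpleGroup

theorem schmidtGraph_quotient_frattini_ne :
    schmidtGraph (frattiniCover ⧸ frattini frattiniCover) ≠ schmidtGraph frattiniCover := by
  intro h
  obtain ⟨e⟩ := nonempty_quotient_frattini_frattiniCover_mulEquiv
  have hedge : ((3, 5) : ℕ × ℕ) ∈ (schmidtGraph frattiniCover).edges :=
    hasSchmidtSubgroup_frattiniCover
  rw [← h, schmidtGraph_eq_of_mulEquiv e] at hedge
  exact not_hasSchmidtSubgroup_alternatingGroup hedge

theorem schmidtGraph_quotient_frattini_eq_of_mulEquiv {G H : Type*} [Group G] [Group H] [Finite G]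
    [Finite H] (e : G ≃* H) :
    schmidtGraph (G ⧸ frattini G) = schmidtGraph (H ⧸ frattini H) :=
  schmidtGraph_eq_of_mulEquiv
    (QuotientGroup.congr _ _ e (OrderIso.map_radical e.mapSubgroup))

theorem schmidtGraph_not_ePhiClosed : ¬ schmidtGraph.{u}.EPhiClosed := fun h => by
  let e : ULift.{u} frattiniCover ≃* frattiniCover := MulEquiv.ulift
  refine schmidtGraph_quotient_frattini_ne ?_
  rw [← schmidtGraph_quotient_frattini_eq_of_mulEquiv e, h, schmidtGraph_eq_of_mulEquiv e]

theorem proposition3p3 :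
    (schmidtGraph.{u}.IsArithmetic ∧ schmidtGraph.{u}.SClosed ∧ schmidtGraph.{u}.QClosed ∧
      schmidtGraph.{u}.D0Closed ∧ schmidtGraph.{u}.R0Closed) ∧
    ¬ schmidtGraph.{u}.EPhiClosed ∧
    -- the counterexample: a Frattini extension `A ↣ R ↠ A₅`
    ∃ (A : Type) (_ : AddCommGroup A) (_ : Module (ZMod 3) A)
      (ρ : Representation (ZMod 3) (alternatingGroup (Fin 5)) A)
      (R : Type) (_ : Group R) (_ : Finite R)
      (S : GroupExtension (Multiplicative A) R (alternatingGroup (Fin 5))),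
      ρ.IsIrreducible ∧ Function.Injective ρ ∧
      IsFrattiniExtension ρ S ∧ S.inl.range = frattini R ∧
      Nonempty (R ⧸ frattini R ≃* alternatingGroup (Fin 5)) ∧
      HasSchmidtSubgroup 3 5 R ∧
      ¬ HasSchmidtSubgroup 3 5 (alternatingGroup (Fin 5)) ∧
      schmidtGraph (R ⧸ frattini R) ≠ schmidtGraph R := by
  have hext := isFrattiniExtension_frattiniCover
  have hrange := hext.range_inl_eq_frattini frattini_eq_bot_of_isSimpleGroup
  exact ⟨⟨schmidtGraph_isArithmetic, schmidtGraph_sClosed, schmidtGraph_qClosed,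
      schmidtGraph_d0Closed, schmidtGraph_r0Closed⟩, schmidtGraph_not_ePhiClosed,
    sumZero (ZMod 3) (Fin 5), inferInstance, inferInstance, deletedPermutationRep,
    frattiniCover, inferInstance, inferInstance, frattiniCoverExtension,
    inferInstance, injective_of_isSimpleGroup deletedPermutationRep_fiveCycle_ne_one,
    hext, hrange, nonempty_quotient_frattini_frattiniCover_mulEquiv,
    hasSchmidtSubgroup_frattiniCover, not_hasSchmidtSubgroup_alternatingGroup,
    schmidtGraph_quotient_frattini_ne⟩
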